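/- Let $k \ge 1$ and let $Q_k$ be the $k$-dimensional hypercube: its vertices are the $2^k$ binary strings of length $k$, two of them being adjacent when they differ in exactly one coordinate. For a set $S$ of vertices, a vertex $x \in S$ is called full in the induced subgraph $Q_k[S]$ if its degree in $Q_k[S]$ is $k$. For $1 \le n \le 2^k$ let $\phi_k(n)$ be the maximum number of full vertices of $Q_k[S]$ over all sets $S$ of exactly $n$ vertices of $Q_k$. For integers $m, j \ge 1$ there is a unique representation $m = \binom{a_j}{j} + \binom{a_{j-1}}{j-1} + \cdots + \binom{a_p}{p}$ with $a_j > a_{j-1} > \cdots > a_p \ge p \ge 1$; put $m^{(j)} = \binom{a_j}{j+1} + \binom{a_{j-1}}{j} + \cdots + \binom{a_p}{p+1}$. Put also $0^{(j)} = 0$ for every $j \ge 0$. Theorem. Let $1 \le n < 2^k$. Then there are unique integers $i \ge 0$ and $m$ with $n = \sum_{\ell=0}^{i} \binom{k}{\ell} + m$ and $0 \le m < \binom{k}{i+1}$, and for these $$\phi_k(n) = \sum_{\ell=0}^{i-1} \binom{k}{\ell} + m^{(k-i-1)}.$$ Moreover, $\phi_k(2^k) = 2^k$. -/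

import Mathlib

open Finset

/-- The hypercube `Q_k`: its vertices are the binary strings of length `k`, and two of them are
adjacent when they differ in exactly one coordinate. -/
def hypercube (k : ℕ) : SimpleGraph (Fin k → Bool) where
  Adj x y := hammingDist x y = 1
  symm := ⟨fun x y h => by rw [hammingDist_comm]; exact h⟩
  loopless := ⟨fun x h => by simp at h⟩

instance hypercubeDecidableAdj (k : ℕ) : DecidableRel (hypercube k).Adj :=
  fun x y => inferInstanceAs (Decidable (hammingDist x y = 1))

/-- The number of full vertices of the induced subgraph `Q_k[S]`, that is, of vertices whose degree
in `Q_k[S]` is `k`. -/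
def fullCount (k : ℕ) (S : Finset (Fin k → Bool)) : ℕ :=
  #{x : (S : Set (Fin k → Bool)) | ((hypercube k).induce (S : Set (Fin k → Bool))).degree x = k}

/-- `φ_k(n)`: the maximum number of full vertices of `Q_k[S]`, over all sets `S` of `n` vertices
of `Q_k` (there is such a set if and only if `n ≤ 2 ^ k`). -/
def maxFull (k n : ℕ) : ℕ :=
  (powersetCard n (univ : Finset (Fin k → Bool))).sup (fullCount k)

/-- `i`, `m` give the hypercube representation of `n`:
`n = C(k,0) + ⋯ + C(k,i) + m` with `0 ≤ m < C(k,i+1)`. -/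
def IsHCR (k n i m : ℕ) : Prop :=
  n = (∑ l ∈ range (i + 1), k.choose l) + m ∧ m < k.choose (i + 1)

/-- `j` and `a` give the binomial representation of `m` with top index `i`:
`m = C(a_i,i) + C(a_{i-1},i-1) + ⋯ + C(a_j,j)` where `a_i > a_{i-1} > ⋯ > a_j ≥ j ≥ 1`.
Only the values of `a` on `{j, …, i}` matter. -/
structure IsUBR (m i j : ℕ) (a : ℕ → ℕ) : Prop where
  one_le : 1 ≤ j
  le_top : j ≤ i
  le_last : j ≤ a j
  lt_succ : ∀ l, j ≤ l → l < i → a l < a (l + 1)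
  sum_eq : m = ∑ l ∈ Icc j i, (a l).choose l

open Classical in
/-- The upper `i`-boundary `m^{(i)}`: if `m = C(a_i,i) + ⋯ + C(a_j,j)` is the binomial
representation of `m`, then `m^{(i)} = C(a_i,i+1) + ⋯ + C(a_j,j+1)`. For `m ≥ 1` and `i ≥ 1` the
representation exists and is unique (`exists_isUBR`, `IsUBR.unique`). The number `0` is the empty
sum, and `0^{(i)} = 0` for every `i`, including `i = 0`. -/
noncomputable def upperBoundary (m i : ℕ) : ℕ :=
  if h : ∃ p : ℕ × (ℕ → ℕ), IsUBR m i p.1 p.2 then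
    ∑ l ∈ Icc h.choose.1 i, (h.choose.2 l).choose (l + 1)
  else 0

theorem IsUBR.le_apply {m i j : ℕ} {a : ℕ → ℕ} (h : IsUBR m i j a) {l : ℕ} (hj : j ≤ l)
    (hl : l ≤ i) : l ≤ a l := by
  induction l, hj using Nat.le_induction with
  | base => exact h.le_last
  | succ l hj ih =>
    have h1 := h.lt_succ l hj (by omega)
    have h2 := ih (by omega)
    omega

theorem IsUBR.choose_le {m i j : ℕ} {a : ℕ → ℕ} (h : IsUBR m i j a) :
    (a i).choose i ≤ m := by
  rw [h.sum_eq]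
  exact single_le_sum (f := fun l => (a l).choose l) (fun _ _ => Nat.zero_le _)
    (mem_Icc.2 ⟨h.le_top, le_rfl⟩)

theorem IsUBR.pos {m i j : ℕ} {a : ℕ → ℕ} (h : IsUBR m i j a) : 0 < m :=
  lt_of_lt_of_le (Nat.choose_pos (h.le_apply h.le_top le_rfl)) h.choose_le

/-- Dropping the leading term of a binomial representation. -/
theorem IsUBR.tail {m i j : ℕ} {a : ℕ → ℕ} (h : IsUBR m (i + 1) j a) (hj : j ≤ i) :
    ∃ r, IsUBR r i j a ∧ m = r + (a (i + 1)).choose (i + 1) :=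
  ⟨∑ l ∈ Icc j i, (a l).choose l,
    ⟨h.one_le, hj, h.le_last, fun l h1 h2 => h.lt_succ l h1 (by omega), rfl⟩, by
    rw [h.sum_eq, sum_Icc_succ_top (by omega)]⟩

theorem IsUBR.lt_choose {m i j : ℕ} {a : ℕ → ℕ} (h : IsUBR m i j a) :
    m < (a i + 1).choose i := by
  induction i generalizing m with
  | zero => have := h.one_le; have := h.le_top; omega
  | succ i ih =>
    rcases Nat.lt_or_ge i j with hij | hij
    · have hji : j = i + 1 := by have := h.le_top; omega
      have hm := h.sum_eq
      have h1 := h.le_apply h.le_top le_rfl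
      rw [hji, Icc_self, sum_singleton] at hm
      have h2 : 0 < (a (i + 1)).choose i := Nat.choose_pos (by omega)
      rw [Nat.choose_succ_succ, Nat.succ_eq_add_one]
      omega
    · obtain ⟨r, hr, hm⟩ := h.tail hij
      have h1 := ih hr
      have h2 : (a i + 1).choose i ≤ (a (i + 1)).choose i :=
        Nat.choose_le_choose i (h.lt_succ i hij (by omega))
      rw [Nat.choose_succ_succ, Nat.succ_eq_add_one]
      omega

/-- The binomial representation is unique. -/
theorem IsUBR.unique {m i j j' : ℕ} {a a' : ℕ → ℕ} (h : IsUBR m i j a) (h' : IsUBR m i j' a') :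
    j = j' ∧ ∀ l, j ≤ l → l ≤ i → a l = a' l := by
  have key : ∀ {b b' : ℕ → ℕ} {p p' : ℕ}, IsUBR m i p b → IsUBR m i p' b' → b i ≤ b' i := by
    intro b b' p p' hb hb'
    by_contra hlt
    have h1 := Nat.choose_le_choose i (by omega : b' i + 1 ≤ b i)
    have h2 := hb.choose_le
    have h3 := hb'.lt_choose
    omega
  have htop : a i = a' i := le_antisymm (key h h') (key h' h)
  clear key
  induction i generalizing m with
  | zero => have := h.one_le; have := h.le_top; omega
  | succ i ih =>
    have hj := h.le_top
    have hj' := h'.le_top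
    rcases Nat.lt_or_ge i j with hij | hij <;> rcases Nat.lt_or_ge i j' with hij' | hij'
    · refine ⟨by omega, fun l h1 h2 => ?_⟩
      obtain rfl : l = i + 1 := by omega
      exact htop
    · obtain ⟨r, hr, hm⟩ := h'.tail hij'
      have hm' := h.sum_eq
      have h0 := hr.pos
      rw [show j = i + 1 by omega, Icc_self, sum_singleton, htop] at hm'
      omega
    · obtain ⟨r, hr, hm⟩ := h.tail hij
      have hm' := h'.sum_eq
      have h0 := hr.pos
      rw [show j' = i + 1 by omega, Icc_self, sum_singleton, ← htop] at hm'
      omega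
    · obtain ⟨r, hr, hm⟩ := h.tail hij
      obtain ⟨r', hr', hm'⟩ := h'.tail hij'
      obtain rfl : r = r' := by rw [htop] at hm; omega
      have key : ∀ {b b' : ℕ → ℕ} {p p' : ℕ}, IsUBR r i p b → IsUBR r i p' b' → b i ≤ b' i := by
        intro b b' p p' hb hb'
        by_contra hlt
        have h1 := Nat.choose_le_choose i (by omega : b' i + 1 ≤ b i)
        have h2 := hb.choose_le
        have h3 := hb'.lt_choose
        omega
      obtain ⟨e, he⟩ := ih hr hr' (le_antisymm (key hr hr') (key hr' hr))
      refine ⟨e, fun l h1 h2 => ?_⟩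
      rcases Nat.lt_or_ge i l with hl | hl
      · obtain rfl : l = i + 1 := by omega
        exact htop
      · exact he l h1 hl

/-- The binomial representation exists. -/
theorem exists_isUBR {m i : ℕ} (hm : 1 ≤ m) (hi : 1 ≤ i) : ∃ j a, IsUBR m i j a := by
  induction i, hi using Nat.le_induction generalizing m with
  | base =>
    exact ⟨1, fun _ => m, le_rfl, le_rfl, hm, fun l h1 h2 => by omega, by simp⟩
  | succ i hi ih =>
    have hex : ∃ b : ℕ, m < b.choose (i + 1) := by
      refine ⟨m + 1 + i, ?_⟩
      clear hm
      induction m with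
      | zero => exact Nat.choose_pos (by omega)
      | succ m ihm =>
        have h1 : 0 < (m + 1 + i).choose i := Nat.choose_pos (by omega)
        rw [show m + 1 + 1 + i = (m + 1 + i) + 1 by omega, Nat.choose_succ_succ, Nat.succ_eq_add_one]
        omega
    obtain ⟨c, hc⟩ : ∃ c, Nat.find hex = c + 1 := by
      refine Nat.exists_eq_succ_of_ne_zero fun h0 => ?_
      have := Nat.find_spec hex
      rw [h0] at this
      simp at this
    have h1 : m < (c + 1).choose (i + 1) := hc ▸ Nat.find_spec hex
    have h2 : c.choose (i + 1) ≤ m := not_lt.1 (Nat.find_min hex (by omega))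
    have h3 : i + 1 ≤ c := by
      by_contra hlt
      have h4 := Nat.choose_le_choose (i + 1) (by omega : c + 1 ≤ i + 1)
      rw [Nat.choose_self] at h4
      omega
    rw [Nat.choose_succ_succ, Nat.succ_eq_add_one] at h1
    obtain ⟨r, rfl⟩ := Nat.exists_eq_add_of_le h2
    rcases Nat.eq_zero_or_pos r with rfl | hr
    · exact ⟨i + 1, fun _ => c, by omega, le_rfl, h3, fun l h4 h5 => by omega, by simp⟩
    · obtain ⟨j, a, ha⟩ := ih hr
      have hji := ha.le_top
      have hlt : a i < c := by
        by_contra hge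
        have h4 := Nat.choose_le_choose i (by omega : c ≤ a i)
        have h5 := ha.choose_le
        omega
      refine ⟨j, fun l => if l ≤ i then a l else c, ha.one_le, by omega, ?_, ?_, ?_⟩
      · simpa [hji] using ha.le_last
      · intro l h4 h5
        rcases Nat.lt_or_ge l i with h6 | h6
        · simpa [h6.le, Nat.succ_le_of_lt h6] using ha.lt_succ l h4 h6
        · obtain rfl : l = i := by omega
          simpa using hlt
      · rw [sum_Icc_succ_top (by omega), add_comm]
        congr 1
        · rw [ha.sum_eq]
          exact sum_congr rfl fun l hl => by simp [(mem_Icc.1 hl).2]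
        · simp

theorem IsUBR.upperBoundary_eq {m i j : ℕ} {a : ℕ → ℕ} (h : IsUBR m i j a) :
    upperBoundary m i = ∑ l ∈ Icc j i, (a l).choose (l + 1) := by
  have hex : ∃ p : ℕ × (ℕ → ℕ), IsUBR m i p.1 p.2 := ⟨(j, a), h⟩
  rw [upperBoundary, dif_pos hex]
  obtain ⟨e, he⟩ := h.unique hex.choose_spec
  rw [← e]
  exact sum_congr rfl fun l hl => by rw [he l (mem_Icc.1 hl).1 (mem_Icc.1 hl).2]

theorem upperBoundary_zero (i : ℕ) : upperBoundary 0 i = 0 :=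
  dif_neg fun ⟨_, hp⟩ => lt_irrefl 0 hp.pos

/-! A vertex of S is full exactly when all its k flips lie in S, so φ_k(n) is the largest size of an
interior `cubeInterior S`. Order strings by weight, ties broken in favour of a one at the first
difference. By Harper's theorem (`IsSimplicialInit.card_cubeInterior_le`) the initial segment of
size n is optimal. The proof is by compression: replacing both slices in some direction by initial
segments of equal size does not shrink the interior, because initial segments are nested and their
interiors are again initial segments (`IsSimplicialInit.interior`). A set that cannot be compressed
further is an initial segment, or differs from one by a single swap of complementary strings, which
is checked directly.

The interior of an initial segment is then computed by induction on k, splitting along the first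
coordinate (`IsSimplicialInit.card_interior_eq`). One of the two slices is a Hamming ball and the
other is an initial segment carrying the remainder. Pascal's rule, together with removal of the
leading binomial term (`upperBoundary_choose_add`), matches the two sides. -/

variable {k : ℕ}

/-! ### Flips, weights and full vertices -/

/-- The number of ones of a binary string. -/
def weight (x : Fin k → Bool) : ℕ := ∑ i, (x i).toNat

/-- The string `x` with its `i`-th bit flipped. -/
def flipAt (i : Fin k) (x : Fin k → Bool) : Fin k → Bool := Function.update x i (!x i)

/-- The sort key of the simplicial order: by weight, then reverse lexicographically. -/
def simplicialKey (x : Fin k → Bool) : ℕ ×ₗ (Lex (Fin k → Bool))ᵒᵈ :=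
  toLex (weight x, OrderDual.toDual (toLex x))

/-- Initial segments of the simplicial order. -/
def IsSimplicialInit (S : Finset (Fin k → Bool)) : Prop :=
  ∀ y ∈ S, ∀ x, simplicialKey x ≤ simplicialKey y → x ∈ S

/-- The elements of `S` all of whose neighbours lie in `S`. -/
def cubeInterior (S : Finset (Fin k → Bool)) : Finset (Fin k → Bool) :=
  {x ∈ S | ∀ i, flipAt i x ∈ S}

theorem mem_cubeInterior {S : Finset (Fin k → Bool)} {x : Fin k → Bool} :
    x ∈ cubeInterior S ↔ x ∈ S ∧ ∀ i, flipAt i x ∈ S := by simp [cubeInterior]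

theorem cubeInterior_subset (S : Finset (Fin k → Bool)) : cubeInterior S ⊆ S :=
  filter_subset _ _

theorem cubeInterior_mono {S T : Finset (Fin k → Bool)} (h : S ⊆ T) :
    cubeInterior S ⊆ cubeInterior T := fun x hx => by
  rw [mem_cubeInterior] at hx ⊢
  exact ⟨h hx.1, fun i => h (hx.2 i)⟩

theorem flipAt_self (i : Fin k) (x : Fin k → Bool) : flipAt i x i = !x i := by simp [flipAt]

theorem flipAt_of_ne {i j : Fin k} (h : j ≠ i) (x : Fin k → Bool) : flipAt i x j = x j := by
  simp [flipAt, h]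

theorem flipAt_flipAt (i : Fin k) (x : Fin k → Bool) : flipAt i (flipAt i x) = x := by
  simp [flipAt]

theorem flipAt_injective_left (x : Fin k → Bool) : Function.Injective fun i => flipAt i x := by
  intro i j h
  by_contra hij
  have := congrFun h i
  simp only [flipAt_self, flipAt_of_ne hij] at this
  simp at this

theorem adj_iff_exists_flipAt {x y : Fin k → Bool} :
    (hypercube k).Adj x y ↔ ∃ i, y = flipAt i x := by
  change hammingDist x y = 1 ↔ _
  rw [hammingDist, card_eq_one]
  refine exists_congr fun i => ?_
  constructor
  · intro h
    funext j
    have := Finset.ext_iff.1 h j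
    simp only [mem_filter, mem_univ, true_and, mem_singleton] at this
    by_cases hj : j = i
    · subst hj
      rw [flipAt_self]
      have := this.2 rfl
      cases hx : x j <;> cases hy : y j <;> simp_all
    · rw [flipAt_of_ne hj]
      by_contra hne
      exact hj (this.1 fun h => hne h.symm)
  · rintro rfl
    ext j
    by_cases hj : j = i
    · subst hj; simp [flipAt_self]
    · simp [flipAt_of_ne hj, hj]

theorem fullCount_eq_card_cubeInterior (S : Finset (Fin k → Bool)) :
    fullCount k S = #(cubeInterior S) := by
  classical
  have hdeg : ∀ x : (S : Set (Fin k → Bool)),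
      ((hypercube k).induce (S : Set (Fin k → Bool))).degree x = k ↔ ∀ i, flipAt i x.1 ∈ S := by
    intro x
    have h1 : ((hypercube k).induce (S : Set (Fin k → Bool))).degree x
        = #{i : Fin k | flipAt i x.1 ∈ S} := by
      rw [← SimpleGraph.card_neighborFinset_eq_degree]
      symm
      refine card_bij (fun i hi => ⟨flipAt i x.1, by simpa using hi⟩) ?_ ?_ ?_
      · intro i hi
        simp only [SimpleGraph.mem_neighborFinset, SimpleGraph.comap_adj]
        exact adj_iff_exists_flipAt.2 ⟨i, rfl⟩
      · intro i _ j _ h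
        exact flipAt_injective_left x.1 (congrArg Subtype.val h)
      · intro y hy
        simp only [SimpleGraph.mem_neighborFinset, SimpleGraph.comap_adj] at hy
        obtain ⟨i, hi⟩ := adj_iff_exists_flipAt.1 hy
        refine ⟨i, ?_, Subtype.ext hi.symm⟩
        simp only [mem_filter, mem_univ, true_and]
        have := y.2
        simp only [Function.Embedding.subtype_apply] at hi
        rw [← hi]
        exact_mod_cast this
    rw [h1]
    conv_lhs => rhs; rw [← Fintype.card_fin k]
    rw [card_eq_iff_eq_univ, filter_eq_self]
    simp
  unfold fullCount
  simp_rw [hdeg]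
  refine card_bij (fun x _ => x.1) ?_ ?_ ?_
  · intro x hx
    rw [mem_cubeInterior]
    exact ⟨by exact_mod_cast x.2, by simpa using hx⟩
  · intro x _ y _ h
    exact Subtype.ext h
  · intro x hx
    rw [mem_cubeInterior] at hx
    exact ⟨⟨x, by exact_mod_cast hx.1⟩, by simpa using hx.2, rfl⟩

/-! ### The simplicial order and its initial segments -/

theorem weight_flipAt_of_false {i : Fin k} {x : Fin k → Bool} (h : x i = false) :
    weight (flipAt i x) = weight x + 1 := by
  unfold weight
  rw [← add_sum_erase univ _ (mem_univ i), ← add_sum_erase univ (fun i => (x i).toNat) (mem_univ i),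
    flipAt_self, h, sum_congr rfl fun j hj => by rw [flipAt_of_ne (ne_of_mem_erase hj)]]
  simp [add_comm]

theorem simplicialKey_lt {x y : Fin k → Bool} : simplicialKey x < simplicialKey y ↔
    weight x < weight y ∨ weight x = weight y ∧
      ∃ d, (∀ j < d, x j = y j) ∧ x d = true ∧ y d = false := by
  rw [simplicialKey, simplicialKey, Prod.Lex.toLex_lt_toLex]
  simp only [OrderDual.toDual_lt_toDual]
  refine or_congr_right (and_congr_right fun _ => ?_)
  change (∃ i, (∀ j, j < i → y j = x j) ∧ y i < x i) ↔ _
  refine exists_congr fun d => and_congr ?_ ?_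
  · exact forall₂_congr fun _ _ => eq_comm
  · rw [Bool.lt_iff, and_comm]

theorem simplicialKey_injective :
    Function.Injective (simplicialKey : (Fin k → Bool) → _) := fun x y h => by
  simpa [simplicialKey] using congrArg (fun p => (ofLex p).2) h

theorem weight_le_of_simplicialKey_le {x y : Fin k → Bool}
    (h : simplicialKey x ≤ simplicialKey y) : weight x ≤ weight y := by
  rcases h.lt_or_eq with h | h
  · rcases simplicialKey_lt.1 h with h | h
    exacts [h.le, h.1.le]
  · rw [simplicialKey_injective h]

theorem simplicialKey_mono {x y : Fin k → Bool} (h : ∀ i, x i = true → y i = true) :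
    simplicialKey x ≤ simplicialKey y := by
  by_cases hxy : x = y
  · rw [hxy]
  refine (simplicialKey_lt.2 (Or.inl ?_)).le
  obtain ⟨i, hi⟩ := Function.ne_iff.1 hxy
  refine sum_lt_sum (fun j _ => ?_) ⟨i, mem_univ i, ?_⟩
  · have := h j
    cases hx : x j <;> cases hy : y j <;> simp_all
  · have := h i
    cases hx : x i <;> cases hy : y i <;> simp_all

/-- If x precedes y, every neighbour of x is dominated by y or by a neighbour of y. Only turning a
zero of x into a one needs care: at equal weights it is compared with y after its last zero is
flipped, the latest upper neighbour of y. -/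
theorem IsSimplicialInit.interior {S : Finset (Fin k → Bool)} (hS : IsSimplicialInit S) :
    IsSimplicialInit (cubeInterior S) := by
  intro y hy x hxy
  rcases hxy.eq_or_lt with hxy | hxy
  · rwa [simplicialKey_injective hxy]
  rw [mem_cubeInterior] at hy ⊢
  refine ⟨hS y hy.1 x hxy.le, fun e => ?_⟩
  cases he : x e with
  | true =>
    refine hS y hy.1 _ (le_trans (simplicialKey_mono fun i hi => ?_) hxy.le)
    by_cases hie : i = e
    · rwa [hie]
    · rwa [flipAt_of_ne hie] at hi
  | false =>
    rcases simplicialKey_lt.1 hxy with hw | ⟨hw, d, hd, hxd, hyd⟩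
    · by_cases hf : ∃ f, y f = false
      · obtain ⟨f, hf⟩ := hf
        refine hS _ (hy.2 f) _ (simplicialKey_lt.2 (Or.inl ?_)).le
        rw [weight_flipAt_of_false hf, weight_flipAt_of_false he]
        omega
      · refine hS y hy.1 _ (simplicialKey_mono fun i _ => ?_)
        simpa using (not_exists.1 hf) i
    · obtain ⟨f, hf, hmax⟩ := exists_max_image ({f | y f = false} : Finset (Fin k)) id
        ⟨d, by simpa using hyd⟩
      simp only [mem_filter, mem_univ, true_and, id] at hf hmax
      have hdf : d ≤ f := hmax d hyd
      refine hS _ (hy.2 f) _ ?_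
      have hww : weight (flipAt e x) = weight (flipAt f y) := by
        rw [weight_flipAt_of_false hf, weight_flipAt_of_false he, hw]
      rcases lt_trichotomy e d with hed | rfl | hed
      · refine (simplicialKey_lt.2 (Or.inr ⟨hww, e, fun j hj => ?_, ?_, ?_⟩)).le
        · rw [flipAt_of_ne hj.ne, flipAt_of_ne (hj.trans (hed.trans_le hdf)).ne,
            hd j (hj.trans hed)]
        · rw [flipAt_self, he]; rfl
        · rw [flipAt_of_ne (hed.trans_le hdf).ne, ← hd e hed, he]
      · simp [hxd] at he
      -- If d is the last zero of y, all later bits of y are ones and the comparison is pointwise;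
      -- otherwise d is still the first difference after both flips.
      · rcases hdf.eq_or_lt with rfl | hdf
        · refine simplicialKey_mono fun j hj => ?_
          rcases lt_trichotomy j d with h | rfl | h
          · rwa [flipAt_of_ne h.ne, ← hd j h, ← flipAt_of_ne (h.trans hed).ne x]
          · rw [flipAt_self, hyd]; rfl
          · rw [flipAt_of_ne h.ne']
            by_contra hj'
            exact absurd (hmax j (by simpa using hj')) (not_le.2 h)
        · refine (simplicialKey_lt.2 (Or.inr ⟨hww, d, fun j hj => ?_, ?_, ?_⟩)).le
          · rw [flipAt_of_ne (hj.trans hed).ne, flipAt_of_ne (hj.trans hdf).ne, hd j hj]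
          · rwa [flipAt_of_ne hed.ne]
          · rwa [flipAt_of_ne hdf.ne]

theorem IsSimplicialInit.total {S T : Finset (Fin k → Bool)} (hS : IsSimplicialInit S)
    (hT : IsSimplicialInit T) : S ⊆ T ∨ T ⊆ S := by
  by_contra! h
  obtain ⟨x, hx, hx'⟩ := not_subset.1 h.1
  obtain ⟨y, hy, hy'⟩ := not_subset.1 h.2
  rcases le_total (simplicialKey x) (simplicialKey y) with h | h
  · exact hx' (hT y hy x h)
  · exact hy' (hS x hx y h)

theorem IsSimplicialInit.subset_of_card_le {S T : Finset (Fin k → Bool)}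
    (hS : IsSimplicialInit S) (hT : IsSimplicialInit T) (h : #S ≤ #T) : S ⊆ T := by
  rcases hS.total hT with h' | h'
  · exact h'
  · exact (eq_of_subset_of_card_le h' h).ge

theorem IsSimplicialInit.eq_of_card_eq {S T : Finset (Fin k → Bool)}
    (hS : IsSimplicialInit S) (hT : IsSimplicialInit T) (h : #S = #T) : S = T :=
  (hS.subset_of_card_le hT h.le).antisymm (hT.subset_of_card_le hS h.ge)

theorem IsSimplicialInit.card_inter {S T : Finset (Fin k → Bool)} (hS : IsSimplicialInit S)
    (hT : IsSimplicialInit T) : #(S ∩ T) = min #S #T := by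
  rcases le_total #S #T with h | h
  · rw [inter_eq_left.2 (hS.subset_of_card_le hT h), min_eq_left h]
  · rw [inter_eq_right.2 (hT.subset_of_card_le hS h), min_eq_right h]

theorem exists_isSimplicialInit {n : ℕ} (hn : n ≤ 2 ^ k) :
    ∃ C : Finset (Fin k → Bool), IsSimplicialInit C ∧ #C = n := by
  induction n with
  | zero => exact ⟨∅, fun y hy => by simp at hy, rfl⟩
  | succ n ih =>
    obtain ⟨C, hC, rfl⟩ := ih (by omega)
    have hne : Cᶜ.Nonempty := by
      rw [← card_pos, card_compl]
      simp only [Fintype.card_pi, Fintype.card_bool, prod_const, card_univ, Fintype.card_fin]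
      omega
    obtain ⟨y, hy, hmin⟩ := exists_min_image _ simplicialKey hne
    rw [mem_compl] at hy
    refine ⟨insert y C, fun z hz x hx => ?_, card_insert_of_notMem hy⟩
    rw [mem_insert] at hz ⊢
    rcases hz with rfl | hz
    · by_cases hxC : x ∈ C
      · exact Or.inr hxC
      · exact Or.inl (simplicialKey_injective (hx.antisymm (hmin x (mem_compl.2 hxC))))
    · exact Or.inr (hC z hz x hx)

/-- `C \ S` and `S \ C` have equal size, and every string of the first precedes every string of the
second. -/
theorem IsSimplicialInit.sum_lt_sum {C S : Finset (Fin k → Bool)} (hC : IsSimplicialInit C)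
    (hcard : #C = #S) (hne : C ≠ S) {f : (Fin k → Bool) → ℕ}
    (hf : ∀ x y, simplicialKey x < simplicialKey y → f x < f y) :
    ∑ x ∈ C, f x < ∑ x ∈ S, f x := by
  have hc : #(C \ S) = #(S \ C) := by
    have h1 := card_sdiff_add_card_inter C S
    have h2 := card_sdiff_add_card_inter S C
    rw [inter_comm] at h2
    omega
  have hpos : (C \ S).Nonempty := by
    rw [sdiff_nonempty]
    exact fun h => hne (eq_of_subset_of_card_le h hcard.ge)
  obtain ⟨m, hm, hmax⟩ := exists_max_image _ f hpos
  have h1 : ∑ x ∈ C \ S, f x ≤ #(C \ S) * f m := by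
    simpa using sum_le_card_nsmul _ _ _ hmax
  have h2 : #(S \ C) * (f m + 1) ≤ ∑ x ∈ S \ C, f x := by
    refine (smul_eq_mul _ _).ge.trans (card_nsmul_le_sum _ _ _ fun y hy => hf m y ?_)
    rw [mem_sdiff] at hm hy
    by_contra h
    exact hy.2 (hC m hm.1 y (not_lt.1 h))
  rw [← hc] at h2
  have h3 := hpos.card_pos
  have h4 := sum_inter_add_sum_sdiff C S f
  have h5 := sum_inter_add_sum_sdiff S C f
  rw [inter_comm] at h5
  nlinarith

/-! ### Slices in a coordinate direction -/

/-- The section of `S` where the `i`-th bit is `b`. -/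
def cubeSlice (i : Fin (k + 1)) (b : Bool) (S : Finset (Fin (k + 1) → Bool)) :
    Finset (Fin k → Bool) :=
  {x | (i.insertNth b x : Fin (k + 1) → Bool) ∈ S}

/-- The set with sections `C b` in direction `i`. -/
def glue (i : Fin (k + 1)) (C : Bool → Finset (Fin k → Bool)) : Finset (Fin (k + 1) → Bool) :=
  {x | i.removeNth x ∈ C (x i)}

theorem mem_cubeSlice {i : Fin (k + 1)} {b : Bool} {S : Finset (Fin (k + 1) → Bool)}
    {x : Fin k → Bool} : x ∈ cubeSlice i b S ↔ (i.insertNth b x : Fin (k + 1) → Bool) ∈ S := by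
  simp [cubeSlice]

theorem cubeSlice_mono (i : Fin (k + 1)) (b : Bool) {S T : Finset (Fin (k + 1) → Bool)}
    (h : S ⊆ T) : cubeSlice i b S ⊆ cubeSlice i b T := fun _ hx => mem_cubeSlice.2 (h (mem_cubeSlice.1 hx))

theorem cubeSlice_glue (i : Fin (k + 1)) (b : Bool) (C : Bool → Finset (Fin k → Bool)) :
    cubeSlice i b (glue i C) = C b := by
  ext x
  rw [mem_cubeSlice]
  simp [glue]

theorem exists_eq_insertNth (i : Fin (k + 1)) (x : Fin (k + 1) → Bool) :
    ∃ z : Fin k → Bool, x = i.insertNth (x i) z :=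
  ⟨i.removeNth x, by simp⟩

theorem sum_eq_sum_cubeSlice (i : Fin (k + 1)) (S : Finset (Fin (k + 1) → Bool))
    (f : (Fin (k + 1) → Bool) → ℕ) :
    ∑ x ∈ S, f x = ∑ b, ∑ z ∈ cubeSlice i b S, f (i.insertNth b z) := by
  have h : ∑ x, (if x ∈ S then f x else 0) =
      ∑ p : Bool × (Fin k → Bool), (if (i.insertNth p.1 p.2 : Fin (k + 1) → Bool) ∈ S
        then f (i.insertNth p.1 p.2) else 0) :=
    ((Fin.insertNthEquiv (fun _ => Bool) i).sum_comp fun x => if x ∈ S then f x else 0).symm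
  rw [← sum_filter, filter_mem_eq_inter, univ_inter] at h
  rw [h, Fintype.sum_prod_type]
  refine sum_congr rfl fun b _ => ?_
  rw [cubeSlice, sum_filter]

theorem card_eq_add_card_cubeSlice (i : Fin (k + 1)) (S : Finset (Fin (k + 1) → Bool)) :
    #S = #(cubeSlice i true S) + #(cubeSlice i false S) := by
  rw [card_eq_sum_ones, sum_eq_sum_cubeSlice i]
  simp

theorem flipAt_insertNth_self (i : Fin (k + 1)) (b : Bool) (x : Fin k → Bool) :
    flipAt i (i.insertNth b x : Fin (k + 1) → Bool) = i.insertNth (!b) x := by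
  simp [flipAt]

theorem flipAt_insertNth_succAbove (i : Fin (k + 1)) (j : Fin k) (b : Bool) (x : Fin k → Bool) :
    flipAt (i.succAbove j) (i.insertNth b x : Fin (k + 1) → Bool)
      = i.insertNth b (flipAt j x) := by
  funext l
  rcases Fin.eq_self_or_eq_succAbove i l with rfl | ⟨l, rfl⟩
  · rw [flipAt_of_ne (Fin.ne_succAbove _ _)]
    simp
  · by_cases h : l = j
    · subst h; simp [flipAt_self]
    · rw [flipAt_of_ne fun h' => h (Fin.succAbove_right_injective h')]
      simp [flipAt_of_ne h]

/-- Flips in the other directions stay in the slice, and the flip at i moves to the same point of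
the opposite slice. -/
theorem cubeSlice_cubeInterior (i : Fin (k + 1)) (b : Bool) (S : Finset (Fin (k + 1) → Bool)) :
    cubeSlice i b (cubeInterior S) = cubeInterior (cubeSlice i b S) ∩ cubeSlice i (!b) S := by
  ext x
  rw [mem_inter, mem_cubeSlice, mem_cubeInterior, mem_cubeInterior, Fin.forall_iff_succAbove i]
  simp only [flipAt_insertNth_self, flipAt_insertNth_succAbove, mem_cubeSlice]
  tauto

theorem card_cubeInterior_eq_add (i : Fin (k + 1)) (S : Finset (Fin (k + 1) → Bool)) :
    #(cubeInterior S) = #(cubeInterior (cubeSlice i true S) ∩ cubeSlice i false S) +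
      #(cubeInterior (cubeSlice i false S) ∩ cubeSlice i true S) := by
  rw [card_eq_add_card_cubeSlice i, cubeSlice_cubeInterior, cubeSlice_cubeInterior]
  rfl

theorem weight_insertNth (i : Fin (k + 1)) (b : Bool) (x : Fin k → Bool) :
    weight (i.insertNth b x : Fin (k + 1) → Bool) = b.toNat + weight x := by
  simp [weight, Fin.sum_univ_succAbove _ i]

/-- A common inserted bit shifts both weights equally and does not affect which bit is the first
difference. -/
theorem simplicialKey_insertNth_lt (i : Fin (k + 1)) (b : Bool) {x y : Fin k → Bool}
    (h : simplicialKey x < simplicialKey y) :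
    simplicialKey (i.insertNth b x : Fin (k + 1) → Bool)
      < simplicialKey (i.insertNth b y : Fin (k + 1) → Bool) := by
  rw [simplicialKey_lt] at h ⊢
  rw [weight_insertNth, weight_insertNth]
  refine h.imp (fun h => by omega) fun ⟨hw, d, hd, hx, hy⟩ =>
    ⟨by omega, i.succAbove d, fun j hj => ?_, by simpa using hx, by simpa using hy⟩
  rcases Fin.eq_self_or_eq_succAbove i j with rfl | ⟨j, rfl⟩
  · simp
  · simpa using hd j ((Fin.strictMono_succAbove i).lt_iff_lt.1 hj)

theorem simplicialKey_insertNth_le (i : Fin (k + 1)) (b : Bool) {x y : Fin k → Bool} :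
    simplicialKey (i.insertNth b x : Fin (k + 1) → Bool)
      ≤ simplicialKey (i.insertNth b y : Fin (k + 1) → Bool) ↔
    simplicialKey x ≤ simplicialKey y := by
  constructor
  · intro h
    by_contra h'
    exact absurd h (not_le.2 (simplicialKey_insertNth_lt i b (not_le.1 h')))
  · intro h
    rcases h.lt_or_eq with h | h
    · exact (simplicialKey_insertNth_lt i b h).le
    · rw [simplicialKey_injective h]

theorem IsSimplicialInit.slice {S : Finset (Fin (k + 1) → Bool)} (hS : IsSimplicialInit S)
    (i : Fin (k + 1)) (b : Bool) : IsSimplicialInit (cubeSlice i b S) := fun y hy x hx => by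
  rw [mem_cubeSlice] at hy ⊢
  exact hS _ hy _ ((simplicialKey_insertNth_le i b).2 hx)

/-! ### Harper's theorem by compression -/

/-- The position of `x` in the simplicial order. -/
noncomputable def simplicialRank (x : Fin k → Bool) : ℕ := #{z | simplicialKey z < simplicialKey x}

theorem simplicialRank_lt {x y : Fin k → Bool} (h : simplicialKey x < simplicialKey y) :
    simplicialRank x < simplicialRank y := by
  refine card_lt_card ((ssubset_iff_of_subset fun z hz => ?_).2 ⟨x, ?_, ?_⟩)
  · simp only [mem_filter, mem_univ, true_and] at hz ⊢
    exact hz.trans h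
  · simpa using h
  · simp

/-- If all slices of `S` are initial segments but `S` is not, then `S` consists of the strings
before some `x ∉ S`, together with one more string, the complement of `x`. -/
theorem exists_of_cubeSlice_isSimplicialInit {S : Finset (Fin (k + 1) → Bool)}
    (hS : ∀ i b, IsSimplicialInit (cubeSlice i b S)) (h : ¬ IsSimplicialInit S) :
    ∃ x y : Fin (k + 1) → Bool, x ∉ S ∧ y ∈ S ∧ simplicialKey x < simplicialKey y ∧
      (∀ i, y i = !x i) ∧ ∀ z, z ∈ S ↔ simplicialKey z < simplicialKey x ∨ z = y := by
  -- If x and y agreed at i, they would lie in a common slice, which is an initial segment.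
  have key : ∀ x y, x ∉ S → y ∈ S → simplicialKey x < simplicialKey y → ∀ i, y i = !x i := by
    intro x y hx hy hxy i
    by_contra hne
    have hi : x i = y i := by cases h1 : x i <;> cases h2 : y i <;> simp_all
    obtain ⟨u, hu⟩ := exists_eq_insertNth i x
    obtain ⟨v, hv⟩ := exists_eq_insertNth i y
    rw [← hi] at hv
    rw [hu, hv] at hxy
    rw [hv, ← mem_cubeSlice] at hy
    rw [hu, ← mem_cubeSlice] at hx
    exact hx (hS _ _ v hy u ((simplicialKey_insertNth_le i _).1 hxy.le))
  unfold IsSimplicialInit at h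
  push Not at h
  obtain ⟨y, hy, x, hxy, hx⟩ := h
  have hlt : simplicialKey x < simplicialKey y :=
    hxy.lt_of_ne fun h => hx (simplicialKey_injective h ▸ hy)
  refine ⟨x, y, hx, hy, hlt, key x y hx hy hlt, fun z => ⟨fun hz => ?_, ?_⟩⟩
  · rcases lt_trichotomy (simplicialKey z) (simplicialKey x) with h | h | h
    · exact Or.inl h
    · exact absurd (simplicialKey_injective h ▸ hz) hx
    · exact Or.inr (funext fun i => by rw [key x z hx hz h i, key x y hx hy hlt i])
  · rintro (hz | rfl)
    · by_contra hzS
      have h1 := key z y hzS hy (hz.trans hlt)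
      have h2 := key x y hx hy hlt
      have : z = x := funext fun i => by
        have := h1 i; have := h2 i
        cases h3 : z i <;> cases h4 : x i <;> simp_all
      rw [this] at hz
      exact lt_irrefl _ hz
    · exact hy

/-- An initial segment with one element `x` replaced by its complement has at most as many
interior points. -/
theorem card_cubeInterior_le_of_complement {S C : Finset (Fin (k + 1) → Bool)}
    (hC : IsSimplicialInit C) (hcard : #C = #S) {x y : Fin (k + 1) → Bool} (hx : x ∉ S)
    (hxy : simplicialKey x < simplicialKey y) (hc : ∀ i, y i = !x i)
    (hmem : ∀ z, z ∈ S ↔ simplicialKey z < simplicialKey x ∨ z = y) :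
    #(cubeInterior S) ≤ #(cubeInterior C) := by
  classical
  have hy : y ∈ S := (hmem y).2 (Or.inr rfl)
  have hne : ∀ i, flipAt i y ≠ y := fun i h => by
    have := congrFun h i
    rw [flipAt_self] at this
    simp at this
  have hbelow : ∀ i, flipAt i y ∈ S → y i = true := by
    intro i hi
    by_contra hyi
    rw [Bool.not_eq_true] at hyi
    rcases (hmem _).1 hi with h | h
    · refine absurd (h.trans hxy) (not_lt.2 (simplicialKey_mono fun j hj => ?_))
      by_cases hji : j = i
      · rw [hji, hyi] at hj; simp at hj
      · rwa [flipAt_of_ne hji]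
    · exact hne i h
  -- An interior y would be all ones, so x would be the zero string and nothing would precede it.
  have hyint : y ∉ cubeInterior S := by
    intro h
    rw [mem_cubeInterior] at h
    have hall : ∀ i, y i = true := fun i => hbelow i (h.2 i)
    have hx0 : ∀ i, x i = false := fun i => by have := hc i; rw [hall i] at this; simpa using this
    rcases (hmem _).1 (h.2 0) with h0 | h0
    · refine absurd h0 (not_lt.2 (simplicialKey_mono fun j hj => ?_))
      rw [hx0 j] at hj; simp at hj
    · exact hne 0 h0
  -- Suppose this neighbour is interior. Refilling any zero f of y gives a string of the weight of y
  -- that precedes x, so x and y have equal weight; being complementary they first differ at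
  -- coordinate 0, where x has the one. The refilled string must then start with a one too, which
  -- forces f = 0.
  have hnb : ∀ i, flipAt i y ∉ cubeInterior S := by
    intro i hi
    rw [mem_cubeInterior] at hi
    have hyi := hbelow i hi.1
    have hwy : weight y = weight (flipAt i y) + 1 := by
      conv_lhs => rw [← flipAt_flipAt i y]
      exact weight_flipAt_of_false (by rw [flipAt_self, hyi]; rfl)
    have hfl : ∀ f, y f = false → simplicialKey (flipAt f (flipAt i y)) < simplicialKey x := by
      intro f hf
      refine ((hmem _).1 (hi.2 f)).resolve_right fun h => ?_
      have hfi : f ≠ i := fun h => by rw [h, hyi] at hf; simp at hf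
      have := congrFun h f
      rw [flipAt_self, flipAt_of_ne hfi, hf] at this
      simp at this
    have hwf : ∀ f, y f = false → weight (flipAt f (flipAt i y)) = weight y := by
      intro f hf
      have hfi : f ≠ i := fun h => by rw [h, hyi] at hf; simp at hf
      rw [weight_flipAt_of_false (by rwa [flipAt_of_ne hfi]), hwy]
    by_cases hex : ∃ f, y f = false
    · obtain ⟨f, hf⟩ := hex
      have hwx : weight x = weight y := by
        have h1 := weight_le_of_simplicialKey_le (hfl f hf).le
        rw [hwf f hf] at h1
        exact le_antisymm (weight_le_of_simplicialKey_le hxy.le) h1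
      have h0 : y 0 = false := by
        rcases simplicialKey_lt.1 hxy with h | ⟨-, d, hd, -, hyd⟩
        · omega
        · by_cases hd0 : d = 0
          · rwa [← hd0]
          · have h1 := hd 0 (Fin.pos_iff_ne_zero.2 hd0)
            have h2 := hc 0
            rw [h1] at h2; simp at h2
      have hf0 : ∀ f, y f = false → f = 0 := by
        intro f hf
        by_contra hf0
        rcases simplicialKey_lt.1 (hfl f hf) with h | ⟨-, d, hd, hd1, hd2⟩
        · rw [hwf f hf] at h; omega
        · by_cases hd0 : d = 0
          · rw [hd0, ← Bool.not_eq_true] at hd2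
            have h2 := hc 0
            rw [h0] at h2
            exact hd2 (by simpa using h2.symm)
          · have h1 := hd 0 (Fin.pos_iff_ne_zero.2 hd0)
            have hi0 : i ≠ 0 := fun h => by rw [h, h0] at hyi; simp at hyi
            rw [flipAt_of_ne (Ne.symm hf0), flipAt_of_ne hi0.symm] at h1
            have h2 := hc 0
            rw [h1] at h2; simp at h2
      -- `x` has weight one, hence so does `y`, so that `x` is a neighbour of `flipAt i y`
      have hx1 : x = flipAt 0 (fun _ => false) := by
        funext j
        by_cases hj : j = 0
        · subst hj
          have := hc 0
          rw [h0] at this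
          rw [flipAt_self]
          simpa using this.symm
        · rw [flipAt_of_ne hj]
          by_contra hxj
          exact hj (hf0 j (by rw [hc j]; simpa using hxj))
      have hw0 : weight (fun _ : Fin (k + 1) => false) = 0 := by simp [weight]
      have hwz : weight (flipAt i y) = 0 := by
        have : weight x = 1 := by rw [hx1, weight_flipAt_of_false rfl, hw0]
        omega
      have hz : flipAt i y = fun _ => false := by
        funext j
        have := sum_eq_zero_iff.1 hwz j (mem_univ j)
        simpa [Bool.toNat_eq_zero] using this
      exact hx (by rw [hx1, ← hz]; exact hi.2 0)
    · have hx0 : ∀ j, x j = false := fun j => by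
        have h1 := hc j
        have h2 := (not_exists.1 hex) j
        rw [Bool.not_eq_false] at h2
        rw [h2] at h1; simpa using h1
      rcases (hmem _).1 hi.1 with h0 | h0
      · refine absurd h0 (not_lt.2 (simplicialKey_mono fun j hj => ?_))
        rw [hx0 j] at hj; simp at hj
      · exact hne i h0
  have hsub : S.erase y ⊆ C := by
    have hinit : IsSimplicialInit (S.erase y) := by
      intro z hz w hw
      rw [mem_erase] at hz
      have h1 := ((hmem z).1 hz.2).resolve_right hz.1
      refine mem_erase.2 ⟨?_, (hmem w).2 (Or.inl (hw.trans_lt h1))⟩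
      rintro rfl
      exact absurd ((hw.trans_lt h1).trans hxy) (lt_irrefl _)
    exact hinit.subset_of_card_le hC (hcard ▸ card_le_card (erase_subset _ _))
  -- Neither y nor any neighbour of y is interior, so removing y loses no interior point.
  refine card_le_card (Subset.trans (fun z hz => ?_) (cubeInterior_mono hsub))
  have hz' := mem_cubeInterior.1 hz
  rw [mem_cubeInterior]
  refine ⟨mem_erase.2 ⟨fun h => hyint (h ▸ hz), hz'.1⟩, fun i => mem_erase.2 ⟨fun h => ?_, hz'.2 i⟩⟩
  apply hnb i
  rwa [← h, flipAt_flipAt]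

/-- **Harper's theorem**: initial segments of the simplicial order have the largest interior. -/
theorem IsSimplicialInit.card_cubeInterior_le {C S : Finset (Fin k → Bool)}
    (hC : IsSimplicialInit C) (hcard : #C = #S) : #(cubeInterior S) ≤ #(cubeInterior C) := by
  induction k with
  | zero =>
    have hS : IsSimplicialInit S := fun y hy x _ => Subsingleton.elim y x ▸ hy
    rw [hC.eq_of_card_eq hS hcard]
  | succ k ih =>
    -- The total rank strictly drops under each effective compression, so compression terminates.
    induction hr : ∑ x ∈ S, simplicialRank x using Nat.strong_induction_on generalizing S with
    | _ r ihr =>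
    subst hr
    by_cases hS : IsSimplicialInit S
    · rw [hC.eq_of_card_eq hS hcard]
    by_cases hsl : ∀ i b, IsSimplicialInit (cubeSlice i b S)
    · obtain ⟨x, y, hx, -, hxy, hc, hmem⟩ := exists_of_cubeSlice_isSimplicialInit hsl hS
      exact card_cubeInterior_le_of_complement hC hcard hx hxy hc hmem
    · push Not at hsl
      obtain ⟨i, b, hb⟩ := hsl
      have hex : ∀ c, ∃ D : Finset (Fin k → Bool), IsSimplicialInit D ∧ #D = #(cubeSlice i c S) :=
        fun c => exists_isSimplicialInit (by simpa using card_le_univ (cubeSlice i c S))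
      choose D hD hDcard using hex
      have hcard' : #(glue i D) = #S := by
        rw [card_eq_add_card_cubeSlice i, card_eq_add_card_cubeSlice i S, cubeSlice_glue, cubeSlice_glue,
          hDcard, hDcard]
      have hlt : ∑ x ∈ glue i D, simplicialRank x < ∑ x ∈ S, simplicialRank x := by
        rw [sum_eq_sum_cubeSlice i, sum_eq_sum_cubeSlice i S]
        simp only [cubeSlice_glue]
        have hstep : ∀ c, D c ≠ cubeSlice i c S →
            ∑ z ∈ D c, simplicialRank (i.insertNth c z : Fin (k + 1) → Bool)
              < ∑ z ∈ cubeSlice i c S, simplicialRank (i.insertNth c z : Fin (k + 1) → Bool) :=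
          fun c hne => (hD c).sum_lt_sum (hDcard c) hne
            fun x y h => simplicialRank_lt (simplicialKey_insertNth_lt i c h)
        refine Finset.sum_lt_sum (fun c _ => ?_) ⟨b, mem_univ b, hstep b fun h => hb (h ▸ hD b)⟩
        by_cases h : D c = cubeSlice i c S
        · rw [h]
        · exact (hstep c h).le
      refine le_trans ?_ (ihr _ hlt (hcard.trans hcard'.symm) rfl)
      -- On the compressed side both sets are initial segments, so the intersection has the smaller
      -- of their sizes, an upper bound for the original intersection by the induction on dimension.
      have hstep : ∀ c c', #(cubeInterior (cubeSlice i c S) ∩ cubeSlice i c' S)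
          ≤ #(cubeInterior (D c) ∩ D c') := by
        intro c c'
        rw [(hD c).interior.card_inter (hD c'), hDcard]
        exact le_min ((card_le_card inter_subset_left).trans (ih (hD c) (hDcard c)))
          (card_le_card inter_subset_right)
      rw [card_cubeInterior_eq_add i, card_cubeInterior_eq_add i (glue i D), cubeSlice_glue, cubeSlice_glue]
      exact add_le_add (hstep _ _) (hstep _ _)

/-! ### Hamming balls and binomial sums -/

theorem sum_range_succ_choose_succ (k i : ℕ) :
    ∑ l ∈ range (i + 1), (k + 1).choose l =
      ∑ l ∈ range (i + 1), k.choose l + ∑ l ∈ range i, k.choose l := by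
  induction i with
  | zero => simp
  | succ i ih =>
    rw [sum_range_succ, ih, sum_range_succ _ (i + 1), sum_range_succ _ i, Nat.choose_succ_succ]
    ring

/-- The Hamming ball of strings of weight less than `i`. -/
def hammingBall (k i : ℕ) : Finset (Fin k → Bool) := {x | weight x < i}

theorem mem_hammingBall {i : ℕ} {x : Fin k → Bool} : x ∈ hammingBall k i ↔ weight x < i := by
  simp [hammingBall]

theorem isSimplicialInit_hammingBall (k i : ℕ) : IsSimplicialInit (hammingBall k i) :=
  fun _ hy _ hx => mem_hammingBall.2
    ((weight_le_of_simplicialKey_le hx).trans_lt (mem_hammingBall.1 hy))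

theorem cubeSlice_false_hammingBall (j : Fin (k + 1)) (i : ℕ) :
    cubeSlice j false (hammingBall (k + 1) i) = hammingBall k i := by
  ext x
  simp [mem_cubeSlice, mem_hammingBall, weight_insertNth]

theorem cubeSlice_true_hammingBall (j : Fin (k + 1)) (i : ℕ) :
    cubeSlice j true (hammingBall (k + 1) (i + 1)) = hammingBall k i := by
  ext x
  simp [mem_cubeSlice, mem_hammingBall, weight_insertNth, add_comm 1]

theorem card_hammingBall (k i : ℕ) : #(hammingBall k i) = ∑ l ∈ range i, k.choose l := by
  induction k generalizing i with
  | zero =>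
    cases i with
    | zero => simp [hammingBall]
    | succ i => simp [hammingBall, weight, sum_range_succ']
  | succ k ih =>
    cases i with
    | zero => simp [hammingBall]
    | succ i =>
      rw [card_eq_add_card_cubeSlice 0, cubeSlice_false_hammingBall, cubeSlice_true_hammingBall, ih, ih,
        sum_range_succ_choose_succ, add_comm]

/-- The strings whose weight, not counting the first bit, is less than `i`, form an initial
segment. -/
theorem isSimplicialInit_glue_hammingBall (k i : ℕ) :
    IsSimplicialInit (glue 0 fun _ => hammingBall k i) := by
  intro y hy x hxy
  obtain ⟨u, hu⟩ := exists_eq_insertNth 0 x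
  obtain ⟨v, hv⟩ := exists_eq_insertNth 0 y
  rw [hv, ← mem_cubeSlice, cubeSlice_glue, mem_hammingBall] at hy
  rw [hu, ← mem_cubeSlice, cubeSlice_glue, mem_hammingBall]
  have hwx := weight_insertNth 0 (x 0) u
  have hwy := weight_insertNth 0 (y 0) v
  rw [← hu] at hwx
  rw [← hv] at hwy
  rcases hxy.eq_or_lt with h | h
  · obtain rfl := simplicialKey_injective h
    omega
  -- A smaller total weight absorbs a first bit of at most one; at equal weights the earlier string
  -- has the larger first bit.
  have hb : (y 0).toNat ≤ 1 := Bool.toNat_le _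
  rcases simplicialKey_lt.1 h with h | ⟨h, d, hd, hx, hy'⟩
  · omega
  · have : (y 0).toNat ≤ (x 0).toNat := by
      by_cases hd0 : d = 0
      · subst hd0; rw [hx, hy']; simp
      · rw [hd 0 (Fin.pos_iff_ne_zero.2 hd0)]
    omega

theorem card_glue_hammingBall (k i : ℕ) :
    #(glue 0 fun _ => hammingBall k i) = 2 * ∑ l ∈ range i, k.choose l := by
  rw [card_eq_add_card_cubeSlice 0, cubeSlice_glue, cubeSlice_glue, card_hammingBall, two_mul]

/-- The bound on r makes the leading coefficient of its representation less than c, so prepending c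
gives a valid representation. For j = 1 it forces r = 0. -/
theorem upperBoundary_choose_add {c j r : ℕ} (hj : 1 ≤ j) (hjc : j ≤ c)
    (hr : r < c.choose (j - 1)) :
    upperBoundary (c.choose j + r) j = c.choose (j + 1) + upperBoundary r (j - 1) := by
  rcases Nat.eq_zero_or_pos r with rfl | hpos
  · have h : IsUBR (c.choose j + 0) j j (fun _ => c) :=
      ⟨hj, le_rfl, hjc, fun l h1 h2 => by omega, by simp⟩
    rw [h.upperBoundary_eq, upperBoundary_zero]
    simp
  · obtain ⟨j, rfl⟩ := Nat.exists_eq_add_of_le' hj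
    rw [Nat.add_sub_cancel] at hr ⊢
    have hj1 : 1 ≤ j := by
      by_contra h
      obtain rfl : j = 0 := by omega
      rw [Nat.choose_zero_right] at hr
      omega
    obtain ⟨p, a, ha⟩ := exists_isUBR hpos hj1
    have hp := ha.le_top
    have hlt : a j < c := by
      by_contra hge
      have h4 := Nat.choose_le_choose j (not_lt.1 hge)
      have h5 := ha.choose_le
      omega
    have h : IsUBR (c.choose (j + 1) + r) (j + 1) p (fun l => if l ≤ j then a l else c) := by
      refine ⟨ha.one_le, by omega, by simpa [hp] using ha.le_last, fun l h4 h5 => ?_, ?_⟩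
      · rcases Nat.lt_or_ge l j with h6 | h6
        · simpa [h6.le, Nat.succ_le_of_lt h6] using ha.lt_succ l h4 h6
        · obtain rfl : l = j := by omega
          simpa using hlt
      · rw [sum_Icc_succ_top (by omega), add_comm]
        congr 1
        · rw [ha.sum_eq]
          exact sum_congr rfl fun l hl => by simp [(mem_Icc.1 hl).2]
        · simp
    rw [h.upperBoundary_eq, ha.upperBoundary_eq, sum_Icc_succ_top (by omega), add_comm]
    congr 1
    · simp
    · exact sum_congr rfl fun l hl => by simp [(mem_Icc.1 hl).2]

/-! ### Interior sizes of initial segments -/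

theorem cubeInterior_univ : cubeInterior (univ : Finset (Fin k → Bool)) = univ := by
  simp [cubeInterior]

/-- The interior of an initial segment of size less than that of a ball of radius `i + 1` is no
larger than the ball of radius `i`. -/
theorem IsSimplicialInit.card_interior_le {C : Finset (Fin k → Bool)} (hC : IsSimplicialInit C)
    {i : ℕ} (hi : i < k) (h : #C < ∑ l ∈ range (i + 1 + 1), k.choose l) :
    #(cubeInterior C) ≤ ∑ l ∈ range (i + 1), k.choose l := by
  rcases Nat.lt_or_ge (i + 1) k with hik | hik
  · have hsub : C ⊆ hammingBall k (i + 2) :=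
      hC.subset_of_card_le (isSimplicialInit_hammingBall _ _) (by rw [card_hammingBall]; exact h.le)
    rw [← card_hammingBall]
    refine card_le_card fun x hx => ?_
    rw [mem_cubeInterior] at hx
    rw [mem_hammingBall]
    have hx1 := mem_hammingBall.1 (hsub hx.1)
    -- An interior string of weight i + 1 < k would have an upper neighbour outside the ball
    -- containing C.
    by_contra hlt
    have hw : weight x < k := by omega
    have hex : ∃ j, x j = false := by
      by_contra hne
      push Not at hne
      have : weight x = k := by
        unfold weight
        rw [sum_congr rfl fun j _ => by rw [Bool.eq_true_of_not_eq_false (hne j)]]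
        simp
      omega
    obtain ⟨j, hj⟩ := hex
    have := mem_hammingBall.1 (hsub (hx.2 j))
    rw [weight_flipAt_of_false hj] at this
    omega
  · obtain rfl : k = i + 1 := by omega
    rw [sum_range_succ, Nat.choose_self] at h
    exact (card_le_card (cubeInterior_subset C)).trans (by omega)

/-- The size of the interior of an initial segment of the simplicial order. -/
theorem IsSimplicialInit.card_interior_eq {C : Finset (Fin k → Bool)} (hC : IsSimplicialInit C)
    {i m : ℕ} (h : IsHCR k #C i m) :
    #(cubeInterior C) = (∑ l ∈ range i, k.choose l) + upperBoundary m (k - i - 1) := by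
  induction k generalizing i m with
  | zero =>
    have := h.2
    simp at this
  | succ k ih =>
    obtain ⟨hn, hm⟩ := h
    have hCs := card_eq_add_card_cubeSlice 0 C
    have hi : i ≤ k := by
      by_contra hik
      rw [Nat.choose_eq_zero_of_lt (by omega)] at hm
      omega
    -- a ball has the interior which the formula predicts, unless it is the whole cube
    have hball : i < k → #(cubeInterior (hammingBall k (i + 1))) = ∑ l ∈ range i, k.choose l := by
      intro hik
      rw [ih (isSimplicialInit_hammingBall k (i + 1)) (i := i) (m := 0)
        ⟨by rw [card_hammingBall, add_zero], Nat.choose_pos (by omega)⟩, upperBoundary_zero,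
        add_zero]
    have hsum := sum_range_succ_choose_succ k i
    have hs1 := sum_range_succ (fun l => k.choose l) i
    have hs2 := sum_range_succ (fun l => k.choose l) (i + 1)
    have hs3 := sum_range_succ (fun l => (k + 1).choose l) (i + 1)
    have hchoose : (k + 1).choose (i + 1) = k.choose i + k.choose (i + 1) :=
      Nat.choose_succ_succ k i
    rw [card_cubeInterior_eq_add 0, (hC.slice 0 true).interior.card_inter (hC.slice 0 false),
      (hC.slice 0 false).interior.card_inter (hC.slice 0 true)]
    -- The set of strings whose tail has weight at most i is an initial segment, and m = C(k,i) is
    -- where C reaches it. Below this threshold C lies between the ball of radius i and that set, so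
    -- its false slice is a ball.
    rcases Nat.lt_or_ge m (k.choose i) with hmi | hmi
    · have hF : cubeSlice 0 false C = hammingBall k (i + 1) := by
        apply Subset.antisymm
        · rw [← cubeSlice_glue 0 false fun _ => hammingBall k (i + 1)]
          exact cubeSlice_mono _ _ (hC.subset_of_card_le (isSimplicialInit_glue_hammingBall _ _)
            (by rw [card_glue_hammingBall]; omega))
        · rw [← cubeSlice_false_hammingBall 0]
          exact cubeSlice_mono _ _ ((isSimplicialInit_hammingBall _ _).subset_of_card_le hC
            (by rw [card_hammingBall]; omega))
      have hT : #(cubeSlice 0 true C) = ∑ l ∈ range i, k.choose l + m := by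
        rw [hF, card_hammingBall] at hCs
        omega
      have hle := card_le_card (cubeInterior_subset (cubeSlice 0 true C))
      rw [hF, card_hammingBall, min_eq_left (by omega)]
      have hmin : min #(cubeInterior (hammingBall k (i + 1))) #(cubeSlice 0 true C)
          = ∑ l ∈ range i, k.choose l := by
        rcases hi.lt_or_eq with hik | rfl
        · rw [hball hik, hT]
          omega
        · rw [Nat.choose_self] at hmi
          have hu : hammingBall i (i + 1) = univ := by
            rw [← card_eq_iff_eq_univ, card_hammingBall, Nat.sum_range_choose]
            simp
          rw [hu, cubeInterior_univ, ← hu, card_hammingBall, hT]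
          omega
      rw [hmin]
      cases i with
      | zero =>
        rw [Nat.choose_zero_right] at hmi
        obtain rfl : m = 0 := by omega
        rw [upperBoundary_zero]
        simp only [range_zero, sum_empty] at hT ⊢
        omega
      | succ i =>
        rw [ih (hC.slice 0 true) (i := i) (m := m) ⟨hT, hmi⟩, sum_range_succ_choose_succ,
          show k + 1 - (i + 1) - 1 = k - i - 1 by omega]
        ring
    -- Past the threshold C lies between that set and the ball of radius i + 1, so the true slice is
    -- a ball and the false slice carries the remainder r.
    · obtain ⟨r, rfl⟩ := Nat.exists_eq_add_of_le hmi
      have hr : r < k.choose (i + 1) := by omega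
      have hik : i < k := by
        by_contra hik
        rw [Nat.choose_eq_zero_of_lt (by omega)] at hr
        omega
      have hT : cubeSlice 0 true C = hammingBall k (i + 1) := by
        apply Subset.antisymm
        · rw [← cubeSlice_true_hammingBall 0]
          exact cubeSlice_mono _ _ (hC.subset_of_card_le (isSimplicialInit_hammingBall _ _)
            (by rw [card_hammingBall]; omega))
        · rw [← cubeSlice_glue 0 true fun _ => hammingBall k (i + 1)]
          exact cubeSlice_mono _ _ ((isSimplicialInit_glue_hammingBall _ _).subset_of_card_le hC
            (by rw [card_glue_hammingBall]; omega))
      have hF : #(cubeSlice 0 false C) = ∑ l ∈ range (i + 1), k.choose l + r := by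
        rw [hT, card_hammingBall] at hCs
        omega
      have hle := (hC.slice 0 false).card_interior_le hik (by omega)
      rw [hT, card_hammingBall, hball hik, min_eq_left (by omega), min_eq_left hle,
        ih (hC.slice 0 false) (i := i) (m := r) ⟨hF, hr⟩]
      -- C(k,i) = C(k,k-i) is the leading term of m at top index k-i; it contributes C(k,k-i+1),
      -- which is C(k,i-1) for i ≥ 1 and 0 for i = 0.
      have hub := upperBoundary_choose_add (c := k) (j := k - i) (r := r) (by omega) (by omega)
        (by rwa [← Nat.choose_symm (by omega : k - i - 1 ≤ k),
          show k - (k - i - 1) = i + 1 by omega])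
      rw [Nat.choose_symm hi] at hub
      rw [show k + 1 - i - 1 = k - i by omega, hub]
      cases i with
      | zero => simp
      | succ i =>
        rw [sum_range_succ_choose_succ, sum_range_succ _ i,
          ← Nat.choose_symm (by omega : k - (i + 1) + 1 ≤ k),
          show k - (k - (i + 1) + 1) = i by omega]
        ring

/-! ### The maximum and the representation of n -/

theorem maxFull_eq_card_interior {C : Finset (Fin k → Bool)} (hC : IsSimplicialInit C) :
    maxFull k #C = #(cubeInterior C) := by
  apply le_antisymm
  · refine Finset.sup_le fun S hS => ?_
    rw [fullCount_eq_card_cubeInterior]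
    exact hC.card_cubeInterior_le (mem_powersetCard.1 hS).2.symm
  · rw [← fullCount_eq_card_cubeInterior]
    exact le_sup (f := fullCount k) (mem_powersetCard.2 ⟨subset_univ _, rfl⟩)

theorem IsHCR.unique {n i i' m m' : ℕ} (h : IsHCR k n i m) (h' : IsHCR k n i' m') :
    i = i' ∧ m = m' := by
  have key : ∀ {a b u v : ℕ}, IsHCR k n a u → IsHCR k n b v → a ≤ b := by
    rintro a b u v ⟨h1, -⟩ ⟨h2, h3⟩
    by_contra hlt
    have hle : ∑ l ∈ range (b + 1 + 1), k.choose l ≤ ∑ l ∈ range (a + 1), k.choose l :=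
      sum_le_sum_of_subset (range_subset_range.2 (by omega))
    rw [sum_range_succ] at hle
    omega
  obtain rfl := le_antisymm (key h h') (key h' h)
  have h1 := h.1
  have h2 := h'.1
  exact ⟨rfl, by omega⟩

theorem exists_isHCR {n : ℕ} (hn : 1 ≤ n) (hn' : n < 2 ^ k) : ∃ i m, IsHCR k n i m := by
  have hex : ∃ i, n < ∑ l ∈ range (i + 1), k.choose l := ⟨k, by rwa [Nat.sum_range_choose]⟩
  -- The least radius whose ball has more than n points is positive, since the ball of radius 0 has
  -- one point and n ≥ 1.
  obtain ⟨i, hi⟩ : ∃ i, Nat.find hex = i + 1 := by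
    refine Nat.exists_eq_succ_of_ne_zero fun h0 => ?_
    have := Nat.find_spec hex
    rw [h0] at this
    simp at this
    omega
  have h1 : n < ∑ l ∈ range (i + 1 + 1), k.choose l := hi ▸ Nat.find_spec hex
  have h2 := not_lt.1 (Nat.find_min hex (by omega : i < Nat.find hex))
  rw [sum_range_succ] at h1
  exact ⟨i, n - ∑ l ∈ range (i + 1), k.choose l, by omega, by omega⟩

theorem theorem3p2 (k n : ℕ) (hk : 1 ≤ k) (hn : 1 ≤ n) (hn' : n ≤ 2 ^ k) :
    (n < 2 ^ k → ∃! p : ℕ × ℕ, IsHCR k n p.1 p.2) ∧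
    (∀ i m : ℕ, IsHCR k n i m →
      maxFull k n = (∑ l ∈ Finset.range i, k.choose l) + upperBoundary m (k - i - 1)) ∧
    (n = 2 ^ k → maxFull k n = 2 ^ k) := by
  obtain ⟨C, hC, rfl⟩ := exists_isSimplicialInit hn'
  refine ⟨fun hlt => ?_, fun i m h => ?_, fun h => ?_⟩
  · obtain ⟨i, m, h⟩ := exists_isHCR hn hlt
    exact ⟨(i, m), h, fun p hp => Prod.ext_iff.2 (hp.unique h)⟩
  · rw [maxFull_eq_card_interior hC, hC.card_interior_eq h]
  · have hu : C = univ := by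
      rw [← card_eq_iff_eq_univ, h]
      simp
    rw [maxFull_eq_card_interior hC, hu, cubeInterior_univ, ← hu, h]
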